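/- Let $2<\beta<3$, $w_0>0$ and $\lambda>0$ be constants. For $n\ge 1$ and $d\ge 1$, the standard geometric inhomogeneous random graph (GIRG) $\mathrm{GIRG}(n,\beta,w_0,d)$ is the following random graph on $n$ vertices. Each vertex $v$ independently receives a random weight $w_v$ with the Pareto distribution $\Pr[w_v\le x]=1-(x/w_0)^{1-\beta}$ for $x\ge w_0$, and, independently of all weights, a uniformly random position $\mathbf{x}_v$ on the $d$-dimensional torus $\mathbb{T}^d=\mathbb{R}^d/\mathbb{Z}^d$. Distances on the torus are measured in the $L_\infty$-norm: $\mathrm{dist}(\mathbf{x}_u,\mathbf{x}_v)=\max_{1\le i\le d}\min\{|\mathbf{x}_{ui}-\mathbf{x}_{vi}|,\,1-|\mathbf{x}_{ui}-\mathbf{x}_{vi}|\}$ for coordinates in $[0,1)$. Two vertices $u\ne v$ are adjacent if and only if $$\mathrm{dist}(\mathbf{x}_u,\mathbf{x}_v)\le \frac12\left(\frac{\lambda w_uw_v}{n}\right)^{1/d}.$$ Let $\omega(G)$ denote the clique number of $G$, i.e. the number of vertices of a largest clique. Then $\omega(G)=O(n^{(3-\beta)/2})$ asymptotically almost surely, for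 every choice of the dimension, which may depend on $n$. That is, there is a constant $C>0$, depending only on $\beta$, $w_0$ and $\lambda$, such that for every sequence of dimensions $d=d(n)\ge 1$, the graph $G=\mathrm{GIRG}(n,\beta,w_0,d(n))$ satisfies $$\lim_{n\to\infty}\Pr\left[\omega(G)\le C\,n^{(3-\beta)/2}\right]=1.$$ -/

import Mathlib

open MeasureTheory ProbabilityTheory Filter Topology

noncomputable section

/-- The `d`-dimensional torus, a product of `d` circles of length `1`. Its metric is the maximum
over the coordinates of the distance on the circle, `min (|x - y|) (1 - |x - y|)` for
representatives in `[0, 1)`. -/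
abbrev Torus (d : ℕ) : Type := Fin d → UnitAddCircle

/-- The outcome of the random experiment: each of the `n` vertices carries a weight and a
position on the torus. -/
abbrev GIRGSample (n d : ℕ) : Type := Fin n → ℝ × Torus d

/-- The connection threshold `(1/2) * (lam * w_u * w_v / n) ^ (1 / d)`. -/
def connectionThreshold (n d : ℕ) (lam wu wv : ℝ) : ℝ :=
  (1 / 2) * (lam * wu * wv / (n : ℝ)) ^ (1 / (d : ℝ))

/-- The graph determined by weights and positions: two distinct vertices are adjacent if and only
if their distance on the torus is at most their connection threshold. -/
def girgGraph {n d : ℕ} (lam : ℝ) (ω : GIRGSample n d) : SimpleGraph (Fin n) where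
  Adj u v := u ≠ v ∧ dist (ω u).2 (ω v).2 ≤ connectionThreshold n d lam (ω u).1 (ω v).1
  symm := ⟨fun u v h => ⟨h.1.symm, by
    have h2 := h.2
    rw [dist_comm, connectionThreshold, mul_right_comm lam]
    exact h2⟩⟩
  loopless := ⟨fun _ h => h.1 rfl⟩

/-- The law of weights and positions in a standard GIRG: all weights and positions are
independent, the weights are Pareto distributed with density
`(β - 1) * w₀ ^ (β - 1) * x ^ (-β)` on `[w₀, ∞)`, and the positions are uniform on the torus. -/
def girgMeasure (n : ℕ) (β w₀ : ℝ) (d : ℕ) : Measure (GIRGSample n d) :=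
  Measure.pi fun _ => (paretoMeasure w₀ (β - 1)).prod (volume : Measure (Torus d))

end

/-!
All members of a clique other than its lightest vertex `u` are heavier neighbors of `u`, that is,
neighbors of at least the same weight. Let `u` have weight `a`. A vertex of weight `x` lies within
the connection threshold of `u` with probability at most `min 1 (lam * a * x / n)`, which is at most
`(lam * a * x / n) ^ ((β - 1) / 2)` as `β ≤ 3`. Integrating this power over the Pareto tail
`x ≥ a`, the weight `a` cancels: a given vertex is a heavier neighbor of `u` with probability at
most `2 * (lam * w₀ ^ 2 / n) ^ ((β - 1) / 2)`, whatever the position and weight of `u`, and the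
dimension. Hence the expected number of heavier neighbors is `O(n ^ ((3 - β) / 2))`, and a Chernoff
bound followed by a union bound over `u` gives the claim.
-/

section Rpow

theorem min_one_le_rpow {x s : ℝ} (hx : 0 ≤ x) (hs₀ : 0 ≤ s) (hs₁ : s ≤ 1) : min 1 x ≤ x ^ s := by
  obtain h | h := le_total x 1
  · exact (min_le_right _ _).trans (Real.self_le_rpow_of_le_one hx h hs₁)
  · exact (min_le_left _ _).trans (Real.one_le_rpow h hs₀)

theorem mul_div_rpow_eq {x c s : ℝ} (hx : 0 < x) (hc : 0 ≤ c) :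
    x * (c / x) ^ s = c ^ s * x ^ (1 - s) := by
  rw [Real.div_rpow hc hx.le, Real.rpow_sub hx, Real.rpow_one]
  ring

theorem tendsto_natCast_mul_exp_one_sub_rpow {γ : ℝ} (hγ : 0 < γ) :
    Tendsto (fun n : ℕ => (n : ℝ) * Real.exp (1 - (n : ℝ) ^ γ)) atTop (𝓝 0) := by
  have hlim := ((tendsto_rpow_mul_exp_neg_mul_atTop_nhds_zero (1 / γ) 1 one_pos).comp
    ((tendsto_rpow_atTop hγ).comp tendsto_natCast_atTop_atTop)).const_mul (Real.exp 1)
  rw [mul_zero] at hlim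
  refine hlim.congr fun n => ?_
  simp only [Function.comp_apply]
  rw [← Real.rpow_mul n.cast_nonneg, mul_one_div_cancel hγ.ne', Real.rpow_one, sub_eq_add_neg,
    Real.exp_add, neg_one_mul]
  ring

end Rpow

section Probability

theorem tendsto_measure_one_of_tendsto_measureReal_compl_zero {ι : Type*} {l : Filter ι}
    {Ω : ι → Type*} {mΩ : ∀ i, MeasurableSpace (Ω i)} {P : ∀ i, Measure (Ω i)}
    [∀ i, IsProbabilityMeasure (P i)] {A : ∀ i, Set (Ω i)}
    (h : Tendsto (fun i => (P i).real (A i)ᶜ) l (𝓝 0)) :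
    Tendsto (fun i => P i (A i)) l (𝓝 1) := by
  have hcompl : Tendsto (fun i => 1 - P i (A i)ᶜ) l (𝓝 1) := by
    have hsub := ENNReal.Tendsto.sub (tendsto_const_nhds (x := 1)) (ENNReal.tendsto_ofReal h)
      (Or.inl ENNReal.one_ne_top)
    simpa only [ofReal_measureReal (measure_ne_top _ _), ENNReal.ofReal_zero, tsub_zero] using hsub
  refine tendsto_of_tendsto_of_tendsto_of_le_of_le hcompl tendsto_const_nhds (fun i => ?_)
    fun i => prob_le_one
  rw [tsub_le_iff_right, ← measure_univ (μ := P i), ← Set.union_compl_self (A i)]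
  exact measure_union_le _ _

end Probability

section Chernoff

variable {Ω ι E F : Type*} {mΩ : MeasurableSpace Ω} [MeasurableSpace E] [MeasurableSpace F]
  {P : Measure Ω}

theorem mgf_indicator_one_le_exp [IsProbabilityMeasure P] {A : Set Ω} (hA : MeasurableSet A)
    (θ : ℝ) :
    mgf (A.indicator fun _ => 1) P θ ≤ Real.exp ((Real.exp θ - 1) * P.real A) := by
  have hexp : (fun ω => Real.exp (θ * A.indicator (fun _ => (1 : ℝ)) ω)) =
      fun ω => A.indicator (fun _ => Real.exp θ - 1) ω + 1 := by
    ext ω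
    by_cases hω : ω ∈ A <;> simp [hω]
  calc mgf (A.indicator fun _ => 1) P θ = (Real.exp θ - 1) * P.real A + 1 := by
        rw [mgf, hexp, integral_add ((integrable_const _).indicator hA) (integrable_const 1),
          integral_indicator_const _ hA, integral_const, probReal_univ, smul_eq_mul, smul_eq_mul,
          mul_one, mul_comm]
    _ ≤ Real.exp ((Real.exp θ - 1) * P.real A) := Real.add_one_le_exp _

open scoped Classical in
theorem measureReal_le_card_filter_mem_le_exp {A : ι → Set Ω} (hA : ∀ i, MeasurableSet (A i))
    (hind : iIndepSet A P) (s : Finset ι) (t : ℝ) :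
    P.real {ω | t ≤ Finset.card {i ∈ s | ω ∈ A i}} ≤
      Real.exp ((Real.exp 1 - 1) * ∑ i ∈ s, P.real (A i) - t) := by
  have := hind.isProbabilityMeasure
  set X : ι → Ω → ℝ := fun i => (A i).indicator fun _ => 1 with hX
  have hXm (i : ι) : Measurable (X i) := measurable_const.indicator (hA i)
  have hcard (ω : Ω) : (Finset.card {i ∈ s | ω ∈ A i} : ℝ) = (∑ i ∈ s, X i) ω := by
    simp [hX, Finset.sum_apply, Set.indicator_apply]
  have hint : Integrable (fun ω => Real.exp (1 * (∑ i ∈ s, X i) ω)) P :=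
    hind.iIndepFun_indicator.integrable_exp_mul_sum hXm fun i _ =>
      integrable_exp_mul_of_le 1 1 zero_le_one (hXm i).aemeasurable
        (ae_of_all _ (Set.indicator_le_self' (by simp)))
  simp_rw [hcard]
  calc P.real {ω | t ≤ (∑ i ∈ s, X i) ω}
      ≤ Real.exp (-1 * t) * mgf (∑ i ∈ s, X i) P 1 :=
        measure_ge_le_exp_mul_mgf t zero_le_one hint
    _ = Real.exp (-1 * t) * ∏ i ∈ s, mgf (X i) P 1 := by
        rw [hind.iIndepFun_indicator.mgf_sum hXm]
    _ ≤ Real.exp (-1 * t) * ∏ i ∈ s, Real.exp ((Real.exp 1 - 1) * P.real (A i)) := by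
        gcongr with i
        · exact fun _ _ => mgf_nonneg
        · exact mgf_indicator_one_le_exp (hA i) 1
    _ = Real.exp ((Real.exp 1 - 1) * ∑ i ∈ s, P.real (A i) - t) := by
        rw [← Real.exp_sum, ← Real.exp_add, Finset.mul_sum]
        ring_nf

theorem iIndepSet_preimage_of_iIndepFun {Y : ι → Ω → E} (hY : ∀ i, Measurable (Y i))
    (hind : iIndepFun Y P) {S : ι → Set E} (hS : ∀ i, MeasurableSet (S i)) :
    iIndepSet (fun i => Y i ⁻¹' S i) P :=
  (iIndepSet_iff_meas_biInter fun i => hY i (hS i)).mpr fun _ =>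
    hind.meas_biInter fun i _ => ⟨S i, hS i, rfl⟩

theorem measureReal_prodMk_mem_le_of_indepFun [IsProbabilityMeasure P] {Z : Ω → F} {Y : Ω → E}
    (hZ : Measurable Z) (hY : Measurable Y) (hind : IndepFun Z Y P) {S : Set (F × E)}
    (hS : MeasurableSet S) {c : ℝ} (h : ∀ᵐ ω' ∂P, P.real {ω | (Z ω', Y ω) ∈ S} ≤ c) :
    P.real {ω | (Z ω, Y ω) ∈ S} ≤ c := by
  have hc : 0 ≤ c := by
    obtain ⟨ω', hω'⟩ := h.exists
    exact measureReal_nonneg.trans hω'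
  refine ENNReal.toReal_le_of_le_ofReal hc ?_
  calc P {ω | (Z ω, Y ω) ∈ S} = (P.map fun ω => (Z ω, Y ω)) S :=
        (Measure.map_apply (hZ.prodMk hY) hS).symm
    _ = ((P.map Z).prod (P.map Y)) S := by
        rw [(indepFun_iff_map_prod_eq_prod_map_map hZ.aemeasurable hY.aemeasurable).mp hind]
    _ = ∫⁻ ω', P.map Y (Prod.mk (Z ω') ⁻¹' S) ∂P := by
        have := Measure.isProbabilityMeasure_map (μ := P) hY.aemeasurable
        rw [Measure.prod_apply hS, lintegral_map (measurable_measure_prodMk_left hS) hZ]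
    _ ≤ ∫⁻ _, ENNReal.ofReal c ∂P := by
        refine lintegral_mono_ae (h.mono fun ω' hω' => ?_)
        rw [Measure.map_apply hY (measurable_prodMk_left hS)]
        exact (ENNReal.le_ofReal_iff_toReal_le (measure_ne_top _ _) hc).mpr hω'
    _ = ENNReal.ofReal c := by simp

open scoped Classical in
theorem measurableSet_le_card_filter [Fintype ι] {R : F → E → Prop}
    (hR : MeasurableSet {z : F × E | R z.1 z.2}) (t : ℝ) :
    MeasurableSet {z : F × (ι → E) | t ≤ Finset.card {i | R z.1 (z.2 i)}} := by
  simp only [Finset.card_filter, Nat.cast_sum]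
  refine measurableSet_le measurable_const (Finset.measurable_fun_sum _ fun i _ => ?_)
  have hRi : MeasurableSet {z : F × (ι → E) | R z.1 (z.2 i)} :=
    hR.preimage (f := fun z : F × (ι → E) => (z.1, z.2 i)) (by fun_prop)
  exact measurable_from_top.comp (Measurable.ite hRi measurable_const measurable_const)

open scoped Classical in
theorem measureReal_le_card_filter_le_exp_of_indepFun [Fintype ι] {Z : Ω → F} {Y : ι → Ω → E}
    (hZ : Measurable Z) (hY : ∀ i, Measurable (Y i)) (hYind : iIndepFun Y P)
    (hZY : IndepFun Z (fun ω i => Y i ω) P) {R : F → E → Prop}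
    (hR : MeasurableSet {z : F × E | R z.1 z.2}) {μ : ℝ}
    (hμ : ∀ᵐ ω' ∂P, ∑ i, P.real {ω | R (Z ω') (Y i ω)} ≤ μ) (t : ℝ) :
    P.real {ω | t ≤ Finset.card {i | R (Z ω) (Y i ω)}} ≤
      Real.exp ((Real.exp 1 - 1) * μ - t) := by
  have := hYind.isProbabilityMeasure
  refine measureReal_prodMk_mem_le_of_indepFun hZ (measurable_pi_lambda _ hY) hZY
    (measurableSet_le_card_filter hR t) (hμ.mono fun ω' hω' => ?_)
  have hRm : MeasurableSet {y | R (Z ω') y} := measurable_prodMk_left hR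
  have hchernoff := measureReal_le_card_filter_mem_le_exp (fun i => hY i hRm)
    (iIndepSet_preimage_of_iIndepFun hY hYind fun _ => hRm) Finset.univ t
  refine hchernoff.trans (Real.exp_le_exp.mpr ?_)
  have hexp : 0 ≤ Real.exp 1 - 1 := sub_nonneg.mpr (Real.one_le_exp zero_le_one)
  gcongr
  exact hω'

end Chernoff

section CliqueNumber

variable {V : Type*} [Fintype V]

open scoped Classical in
theorem exists_cliqueNum_le_card_filter_adj_le_add_one [Nonempty V] {α : Type*} [LinearOrder α]
    (G : SimpleGraph V) (f : V → α) :
    ∃ u, G.cliqueNum ≤ Finset.card {v | G.Adj u v ∧ f u ≤ f v} + 1 := by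
  obtain ⟨s, hs⟩ := G.exists_isNClique_cliqueNum
  rw [← hs.card_eq]
  obtain rfl | hne := s.eq_empty_or_nonempty
  · exact ⟨Classical.arbitrary V, by simp⟩
  obtain ⟨u, hu, hmin⟩ := s.exists_min_image f hne
  refine ⟨u, ?_⟩
  rw [← Finset.card_erase_add_one hu]
  gcongr
  intro v hv
  obtain ⟨hvu, hv⟩ := Finset.mem_erase.mp hv
  simpa using ⟨hs.isClique hu hv hvu.symm, hmin v hv⟩

variable [DecidableEq V] {Ω E : Type*} {mΩ : MeasurableSpace Ω} [MeasurableSpace E]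
  {P : Measure Ω} {X : V → Ω → E} {R : E → E → Prop}

open scoped Classical in
theorem measureReal_le_card_filter_ne_le_exp (hX : iIndepFun X P) (hXm : ∀ v, Measurable (X v))
    (hR : MeasurableSet {z : E × E | R z.1 z.2}) (u : V) {μ : ℝ}
    (hμ : ∀ᵐ ω' ∂P, ∑ v : {v // v ≠ u}, P.real {ω | R (X u ω') (X v ω)} ≤ μ) (t : ℝ) :
    P.real {ω | t ≤ Finset.card {v : {v // v ≠ u} | R (X u ω) (X v ω)}} ≤
      Real.exp ((Real.exp 1 - 1) * μ - t) := by
  refine measureReal_le_card_filter_le_exp_of_indepFun (Y := fun v : {v // v ≠ u} => X v) (hXm u)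
    (fun v => hXm v) (hX.precomp Subtype.val_injective) ?_ hR hμ t
  have hind := hX.indepFun_finset {u} (Finset.univ.erase u) (by simp) hXm
  exact hind.comp (measurable_pi_apply ⟨u, Finset.mem_singleton_self u⟩)
    (measurable_pi_lambda (fun x (v : {v // v ≠ u}) => x ⟨v, Finset.mem_erase.mpr ⟨v.2, by simp⟩⟩)
      fun _ => measurable_pi_apply _)

theorem measureReal_lt_cliqueNum_le [Nonempty V] {α : Type*} [LinearOrder α]
    (hX : iIndepFun X P) (hXm : ∀ v, Measurable (X v)) (hR : MeasurableSet {z : E × E | R z.1 z.2})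
    {G : Ω → SimpleGraph V} {f : E → α}
    (hG : ∀ ω u v, (G ω).Adj u v → f (X u ω) ≤ f (X v ω) → R (X u ω) (X v ω)) {μ : ℝ}
    (hμ : ∀ u, ∀ᵐ ω' ∂P, ∑ v : {v // v ≠ u}, P.real {ω | R (X u ω') (X v ω)} ≤ μ) (t : ℝ) :
    P.real {ω | t + 1 < (G ω).cliqueNum} ≤
      Fintype.card V * Real.exp ((Real.exp 1 - 1) * μ - t) := by
  classical
  have := hX.isProbabilityMeasure
  have hsub : {ω | t + 1 < (G ω).cliqueNum} ⊆
      ⋃ u, {ω | t ≤ Finset.card {v : {v // v ≠ u} | R (X u ω) (X v ω)}} := by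
    intro ω hω
    obtain ⟨u, hu⟩ := exists_cliqueNum_le_card_filter_adj_le_add_one (G ω) fun v => f (X v ω)
    have hcard : Finset.card {v | (G ω).Adj u v ∧ f (X u ω) ≤ f (X v ω)} ≤
        Finset.card {v : {v // v ≠ u} | R (X u ω) (X v ω)} := by
      rw [← Finset.card_map (Function.Embedding.subtype _)]
      refine Finset.card_le_card fun v hv => ?_
      obtain ⟨hadj, hle⟩ := (Finset.mem_filter_univ v).mp hv
      simpa using ⟨hG ω u v hadj hle, hadj.ne'⟩
    have hcast : ((G ω).cliqueNum : ℝ) ≤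
        Finset.card {v : {v // v ≠ u} | R (X u ω) (X v ω)} + 1 := by
      exact_mod_cast hu.trans (by gcongr)
    have ht : t + 1 < (G ω).cliqueNum := hω
    exact Set.mem_iUnion.mpr ⟨u, show t ≤ _ by linarith⟩
  calc P.real {ω | t + 1 < (G ω).cliqueNum}
      ≤ ∑ u, P.real {ω | t ≤ Finset.card {v : {v // v ≠ u} | R (X u ω) (X v ω)}} :=
        (measureReal_mono hsub).trans (measureReal_iUnion_fintype_le _)
    _ ≤ ∑ _u : V, Real.exp ((Real.exp 1 - 1) * μ - t) :=
        Finset.sum_le_sum fun u _ => measureReal_le_card_filter_ne_le_exp hX hXm hR u (hμ u) t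
    _ = Fintype.card V * Real.exp ((Real.exp 1 - 1) * μ - t) := by
        rw [Finset.sum_const, Finset.card_univ, nsmul_eq_mul]

end CliqueNumber

section Pareto

theorem ae_le_paretoMeasure (t r : ℝ) : ∀ᵐ x ∂(paretoMeasure t r), t ≤ x := by
  simp only [ae_iff, not_le]
  exact (withDensity_apply _ measurableSet_Iio).trans (lintegral_paretoPDF_of_le le_rfl)

theorem setLIntegral_Ici_rpow_paretoMeasure {t r s a : ℝ} (ht : 0 < t) (hr : 0 < r) (hs : s < r)
    (ha : t ≤ a) :
    ∫⁻ x in Set.Ici a, ENNReal.ofReal (x ^ s) ∂(paretoMeasure t r) =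
      ENNReal.ofReal (r * t ^ r / (r - s) * a ^ (s - r)) := by
  have ha₀ : 0 < a := ht.trans_le ha
  have hpdf : Measurable (paretoPDF t r) := (measurable_paretoPDFReal t r).ennreal_ofReal
  have hdensity : ∀ x ∈ Set.Ici a, (paretoPDF t r * fun x => ENNReal.ofReal (x ^ s)) x =
      ENNReal.ofReal (r * t ^ r * x ^ (s - r - 1)) := fun x hx => by
    have hx₀ : 0 < x := ha₀.trans_le hx
    rw [Pi.mul_apply, paretoPDF_of_le (ha.trans hx), ← ENNReal.ofReal_mul (by positivity),
      mul_assoc, ← Real.rpow_add hx₀]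
    ring_nf
  have hint : IntegrableOn (fun x : ℝ => x ^ (s - r - 1)) (Set.Ioi a) :=
    integrableOn_Ioi_rpow_of_lt (by linarith) ha₀
  have hnonneg : 0 ≤ᵐ[volume.restrict (Set.Ioi a)] fun x => r * t ^ r * x ^ (s - r - 1) :=
    ae_restrict_of_forall_mem measurableSet_Ioi fun x (hx : a < x) => by
      have hx₀ : 0 < x := ha₀.trans hx
      positivity
  rw [paretoMeasure, setLIntegral_withDensity_eq_setLIntegral_mul _
    hpdf (by fun_prop) measurableSet_Ici,
    setLIntegral_congr_fun measurableSet_Ici hdensity, setLIntegral_congr Ioi_ae_eq_Ici.symm,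
    ← ofReal_integral_eq_lintegral_ofReal (hint.const_mul _) hnonneg, integral_const_mul,
    integral_Ioi_rpow_of_lt (by linarith) ha₀, sub_add_cancel, ← neg_sub r s, neg_div_neg_eq,
    mul_div_assoc', div_mul_eq_mul_div]

end Pareto

section Torus

instance isProbabilityMeasure_volume_unitAddCircle :
    IsProbabilityMeasure (volume : Measure UnitAddCircle) :=
  ⟨UnitAddCircle.measure_univ⟩

theorem Torus.volume_closedBall_le {d : ℕ} (x : Torus d) {r : ℝ} (hr : 0 ≤ r) :
    volume (Metric.closedBall x r) ≤ ENNReal.ofReal ((2 * r) ^ d) := by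
  rw [closedBall_pi x hr, volume_pi_pi, ENNReal.ofReal_pow (by positivity)]
  refine (Finset.prod_le_pow_card _ _ (ENNReal.ofReal (2 * r)) fun i _ => ?_).trans_eq (by simp)
  rw [AddCircle.volume_closedBall]
  exact ENNReal.ofReal_le_ofReal (min_le_right _ _)

theorem volume_closedBall_connectionThreshold_le_rpow {n d : ℕ} (hd : d ≠ 0) {lam wu wv s : ℝ}
    (h : 0 ≤ lam * wu * wv / n) (hs₀ : 0 ≤ s) (hs₁ : s ≤ 1) (x : Torus d) :
    volume (Metric.closedBall x (connectionThreshold n d lam wu wv)) ≤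
      ENNReal.ofReal ((lam * wu * wv / n) ^ s) := by
  have hpow : (2 * connectionThreshold n d lam wu wv) ^ d = lam * wu * wv / n := by
    rw [connectionThreshold, ← mul_assoc, mul_one_div_cancel two_ne_zero, one_mul, one_div,
      Real.rpow_inv_natCast_pow h hd]
  have hball := Torus.volume_closedBall_le x
    (show 0 ≤ connectionThreshold n d lam wu wv by unfold connectionThreshold; positivity)
  rw [hpow] at hball
  calc volume (Metric.closedBall x (connectionThreshold n d lam wu wv))
      ≤ min 1 (ENNReal.ofReal (lam * wu * wv / n)) := le_min prob_le_one hball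
    _ = ENNReal.ofReal (min 1 (lam * wu * wv / n)) := by
        rw [ENNReal.ofReal_min, ENNReal.ofReal_one]
    _ ≤ ENNReal.ofReal ((lam * wu * wv / n) ^ s) :=
        ENNReal.ofReal_le_ofReal (min_one_le_rpow h hs₀ hs₁)

end Torus

section HeavierNeighbor

/-- The law of the weight and the position of a single vertex of a standard GIRG. -/
noncomputable def girgVertexMeasure (β w₀ : ℝ) (d : ℕ) : Measure (ℝ × Torus d) :=
  (paretoMeasure w₀ (β - 1)).prod volume

/-- A vertex with weight and position `b` is at least as heavy as a vertex with weight and position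
`a`, and lies within their connection threshold. All vertices of a clique are related in this way
to its lightest vertex. -/
def IsHeavierNeighbor (n : ℕ) {d : ℕ} (lam : ℝ) (a b : ℝ × Torus d) : Prop :=
  a.1 ≤ b.1 ∧ dist a.2 b.2 ≤ connectionThreshold n d lam a.1 b.1

variable {β w₀ lam : ℝ} {n d : ℕ}

theorem isProbabilityMeasure_girgVertexMeasure (hβ : 1 < β) (hw₀ : 0 < w₀) :
    IsProbabilityMeasure (girgVertexMeasure β w₀ d) := by
  have := isProbabilityMeasure_paretoMeasure hw₀ (sub_pos.mpr hβ)
  unfold girgVertexMeasure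
  infer_instance

theorem ae_le_fst_girgVertexMeasure : ∀ᵐ a ∂(girgVertexMeasure β w₀ d), w₀ ≤ a.1 :=
  Measure.quasiMeasurePreserving_fst.ae (ae_le_paretoMeasure w₀ (β - 1))

theorem measurableSet_isHeavierNeighbor :
    MeasurableSet {z : (ℝ × Torus d) × (ℝ × Torus d) | IsHeavierNeighbor n lam z.1 z.2} := by
  have hthreshold : Measurable fun z : (ℝ × Torus d) × (ℝ × Torus d) =>
      connectionThreshold n d lam z.1.1 z.2.1 := by
    unfold connectionThreshold
    fun_prop
  exact (measurableSet_le measurable_fst.fst measurable_snd.fst).inter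
    (measurableSet_le (measurable_fst.snd.dist measurable_snd.snd) hthreshold)

theorem girgVertexMeasure_isHeavierNeighbor_le {s : ℝ} (hβ : 1 < β) (hw₀ : 0 < w₀) (hlam : 0 ≤ lam)
    (hd : d ≠ 0) (hs₀ : 0 ≤ s) (hs₁ : s ≤ 1) (hs : s < β - 1) {a : ℝ × Torus d} (ha : w₀ ≤ a.1) :
    girgVertexMeasure β w₀ d {b | IsHeavierNeighbor n lam a b} ≤
      ENNReal.ofReal ((lam * a.1 / n) ^ s *
        ((β - 1) * w₀ ^ (β - 1) / (β - 1 - s) * a.1 ^ (s - (β - 1)))) := by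
  have ha₀ : 0 < a.1 := hw₀.trans_le ha
  have hslice (x : ℝ) : volume (Prod.mk x ⁻¹' {b | IsHeavierNeighbor n lam a b}) ≤
      (Set.Ici a.1).indicator
        (fun x => ENNReal.ofReal ((lam * a.1 / n) ^ s) * ENNReal.ofReal (x ^ s)) x := by
    by_cases hx : a.1 ≤ x
    · have hx₀ : 0 < x := ha₀.trans_le hx
      rw [Set.indicator_of_mem (Set.mem_Ici.mpr hx), ← ENNReal.ofReal_mul (by positivity),
        ← Real.mul_rpow (by positivity) hx₀.le, div_mul_eq_mul_div]
      refine (measure_mono fun y hy => ?_).trans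
        (volume_closedBall_connectionThreshold_le_rpow hd (by positivity) hs₀ hs₁ a.2)
      exact Metric.mem_closedBall'.mpr hy.2
    · have hempty : Prod.mk x ⁻¹' {b | IsHeavierNeighbor n lam a b} = ∅ :=
        Set.eq_empty_of_forall_notMem fun y hy => hx hy.1
      simp only [hempty, measure_empty, zero_le]
  calc girgVertexMeasure β w₀ d {b | IsHeavierNeighbor n lam a b}
      = ∫⁻ x, volume (Prod.mk x ⁻¹' {b | IsHeavierNeighbor n lam a b})
          ∂(paretoMeasure w₀ (β - 1)) :=
        Measure.prod_apply (measurable_prodMk_left measurableSet_isHeavierNeighbor)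
    _ ≤ ENNReal.ofReal ((lam * a.1 / n) ^ s) *
          ∫⁻ x in Set.Ici a.1, ENNReal.ofReal (x ^ s) ∂(paretoMeasure w₀ (β - 1)) := by
        rw [← lintegral_const_mul _ (by fun_prop), ← lintegral_indicator measurableSet_Ici]
        exact lintegral_mono hslice
    _ = _ := by
        rw [setLIntegral_Ici_rpow_paretoMeasure hw₀ (sub_pos.mpr hβ) hs ha,
          ← ENNReal.ofReal_mul (by positivity)]

theorem girgVertexMeasure_real_isHeavierNeighbor_le (hβ₁ : 1 < β) (hβ₃ : β ≤ 3) (hw₀ : 0 < w₀)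
    (hlam : 0 ≤ lam) (hd : d ≠ 0) {a : ℝ × Torus d} (ha : w₀ ≤ a.1) :
    (girgVertexMeasure β w₀ d).real {b | IsHeavierNeighbor n lam a b} ≤
      2 * (lam * w₀ ^ 2 / n) ^ ((β - 1) / 2) := by
  have ha₀ : 0 < a.1 := hw₀.trans_le ha
  have hs : 0 < (β - 1) / 2 := by linarith
  refine ENNReal.toReal_le_of_le_ofReal (by positivity)
    ((girgVertexMeasure_isHeavierNeighbor_le hβ₁ hw₀ hlam hd hs.le (by linarith) (by linarith)
      ha).trans_eq (congrArg ENNReal.ofReal ?_))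
  set s := (β - 1) / 2
  have hβs : β - 1 = 2 * s := by ring
  have hw : w₀ ^ (2 * s) = (w₀ ^ 2) ^ s := by rw [Real.rpow_mul hw₀.le, Real.rpow_two]
  calc (lam * a.1 / n) ^ s * ((β - 1) * w₀ ^ (β - 1) / (β - 1 - s) * a.1 ^ (s - (β - 1)))
      = (lam / n * a.1) ^ s * (2 * (w₀ ^ 2) ^ s * (a.1 ^ s)⁻¹) := by
        rw [hβs, hw, show s - 2 * s = -s by ring, Real.rpow_neg ha₀.le, mul_div_right_comm lam]
        field_simp
        ring
    _ = 2 * ((lam / n) ^ s * (w₀ ^ 2) ^ s) := by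
        rw [Real.mul_rpow (by positivity) ha₀.le]
        field_simp
    _ = 2 * (lam * w₀ ^ 2 / n) ^ s := by
        rw [← Real.mul_rpow (by positivity) (by positivity), div_mul_eq_mul_div]

end HeavierNeighbor

section GIRG

variable {β w₀ lam : ℝ} {n d : ℕ}

/-- The factor `C` in the bound `C * n ^ ((3 - β) / 2)` on the clique number: the expected number of
heavier neighbors of any vertex is at most `2 * (lam * w₀ ^ 2) ^ ((β - 1) / 2) * n ^ ((3 - β) / 2)`,
the Chernoff bound multiplies this by `exp 1 - 1`, and the summand `1` leaves room for the tail. -/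
noncomputable def girgCliqueFactor (β w₀ lam : ℝ) : ℝ :=
  (Real.exp 1 - 1) * (2 * (lam * w₀ ^ 2) ^ ((β - 1) / 2)) + 1

theorem girgCliqueFactor_pos (hlam : 0 ≤ lam) : 0 < girgCliqueFactor β w₀ lam := by
  have hexp : 0 ≤ Real.exp 1 - 1 := sub_nonneg.mpr (Real.one_le_exp zero_le_one)
  unfold girgCliqueFactor
  positivity

theorem isProbabilityMeasure_girgMeasure (hβ : 1 < β) (hw₀ : 0 < w₀) :
    IsProbabilityMeasure (girgMeasure n β w₀ d) := by
  have := isProbabilityMeasure_girgVertexMeasure (d := d) hβ hw₀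
  exact inferInstanceAs (IsProbabilityMeasure (Measure.pi fun _ => girgVertexMeasure β w₀ d))

theorem ae_sum_girgMeasure_real_isHeavierNeighbor_le (hβ₁ : 1 < β) (hβ₃ : β ≤ 3) (hw₀ : 0 < w₀)
    (hlam : 0 ≤ lam) (hn : n ≠ 0) (hd : d ≠ 0) (u : Fin n) :
    ∀ᵐ ω' ∂(girgMeasure n β w₀ d), ∑ v : {v // v ≠ u},
      (girgMeasure n β w₀ d).real {ω | IsHeavierNeighbor n lam (ω' u) (ω v)} ≤
        2 * (lam * w₀ ^ 2) ^ ((β - 1) / 2) * (n : ℝ) ^ ((3 - β) / 2) := by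
  have := isProbabilityMeasure_girgVertexMeasure (d := d) hβ₁ hw₀
  have heval (v : Fin n) :
      MeasurePreserving (Function.eval v) (girgMeasure n β w₀ d) (girgVertexMeasure β w₀ d) :=
    measurePreserving_eval (fun _ => girgVertexMeasure β w₀ d) v
  filter_upwards [(heval u).quasiMeasurePreserving.ae ae_le_fst_girgVertexMeasure] with ω' hω'
  have hle (v : Fin n) :
      (girgMeasure n β w₀ d).real {ω | IsHeavierNeighbor n lam (ω' u) (ω v)} ≤
        2 * (lam * w₀ ^ 2 / n) ^ ((β - 1) / 2) :=
    ((heval v).measureReal_preimage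
      (measurable_prodMk_left measurableSet_isHeavierNeighbor).nullMeasurableSet).trans_le
      (girgVertexMeasure_real_isHeavierNeighbor_le hβ₁ hβ₃ hw₀ hlam hd hω')
  calc ∑ v : {v // v ≠ u},
        (girgMeasure n β w₀ d).real {ω | IsHeavierNeighbor n lam (ω' u) (ω v)}
      ≤ ∑ _v : {v // v ≠ u}, 2 * (lam * w₀ ^ 2 / n) ^ ((β - 1) / 2) :=
        Finset.sum_le_sum fun v _ => hle v
    _ ≤ n * (2 * (lam * w₀ ^ 2 / n) ^ ((β - 1) / 2)) := by
        rw [Finset.sum_const, nsmul_eq_mul]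
        gcongr
        simp
    _ = 2 * (n * (lam * w₀ ^ 2 / n) ^ ((β - 1) / 2)) := by ring
    _ = 2 * (lam * w₀ ^ 2) ^ ((β - 1) / 2) * (n : ℝ) ^ ((3 - β) / 2) := by
        rw [mul_div_rpow_eq (by positivity) (by positivity), ← mul_assoc]
        ring_nf

theorem girgMeasure_real_lt_cliqueNum_le (hβ₁ : 1 < β) (hβ₃ : β ≤ 3) (hw₀ : 0 < w₀)
    (hlam : 0 ≤ lam) (hn : n ≠ 0) (hd : d ≠ 0) :
    (girgMeasure n β w₀ d).real {ω | girgCliqueFactor β w₀ lam * (n : ℝ) ^ ((3 - β) / 2) <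
        (girgGraph lam ω).cliqueNum} ≤
      n * Real.exp (1 - (n : ℝ) ^ ((3 - β) / 2)) := by
  have := isProbabilityMeasure_girgVertexMeasure (d := d) hβ₁ hw₀
  have : Nonempty (Fin n) := Fin.pos_iff_nonempty.mp (Nat.pos_of_ne_zero hn)
  have hindep : iIndepFun (fun v (ω : GIRGSample n d) => ω v) (girgMeasure n β w₀ d) :=
    iIndepFun_pi (μ := fun _ => girgVertexMeasure β w₀ d) fun _ => aemeasurable_id
  have hbound := measureReal_lt_cliqueNum_le hindep measurable_pi_apply
    measurableSet_isHeavierNeighbor (G := girgGraph lam) (f := Prod.fst)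
    (fun _ _ _ hadj hle => ⟨hle, hadj.2⟩)
    (ae_sum_girgMeasure_real_isHeavierNeighbor_le hβ₁ hβ₃ hw₀ hlam hn hd)
    (girgCliqueFactor β w₀ lam * (n : ℝ) ^ ((3 - β) / 2) - 1)
  have hexponent : (Real.exp 1 - 1) *
        (2 * (lam * w₀ ^ 2) ^ ((β - 1) / 2) * (n : ℝ) ^ ((3 - β) / 2)) -
      (girgCliqueFactor β w₀ lam * (n : ℝ) ^ ((3 - β) / 2) - 1) =
        1 - (n : ℝ) ^ ((3 - β) / 2) := by
    unfold girgCliqueFactor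
    ring
  rwa [sub_add_cancel, Fintype.card_fin, hexponent] at hbound

end GIRG

theorem mainTheorem9_general (β w₀ lam : ℝ) (hβ₁ : 1 < β) (hβ₃ : β < 3) (hw₀ : 0 < w₀)
    (hlam : 0 ≤ lam) :
    ∃ C : ℝ, 0 < C ∧ ∀ d : ℕ → ℕ, (∀ n, 1 ≤ d n) →
      Tendsto
        (fun n : ℕ => girgMeasure n β w₀ (d n)
          {ω | ((girgGraph lam ω).cliqueNum : ℝ) ≤ C * (n : ℝ) ^ ((3 - β) / 2)})
        atTop (𝓝 1) := by
  refine ⟨girgCliqueFactor β w₀ lam, girgCliqueFactor_pos hlam, fun d hd => ?_⟩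
  have (n : ℕ) := isProbabilityMeasure_girgMeasure (n := n) (d := d n) hβ₁ hw₀
  refine tendsto_measure_one_of_tendsto_measureReal_compl_zero
    (squeeze_zero' (Eventually.of_forall fun n => measureReal_nonneg) ?_
      (tendsto_natCast_mul_exp_one_sub_rpow (show 0 < (3 - β) / 2 by linarith)))
  filter_upwards [eventually_ne_atTop 0] with n hn
  simpa only [Set.compl_ofPred, not_le] using
    girgMeasure_real_lt_cliqueNum_le hβ₁ hβ₃.le hw₀ hlam hn (Nat.one_le_iff_ne_zero.mp (hd n))

theorem mainTheorem9 (β w₀ lam : ℝ) (hβ₂ : 2 < β) (hβ₃ : β < 3) (hw₀ : 0 < w₀) (hlam : 0 < lam) :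
    ∃ C : ℝ, 0 < C ∧ ∀ d : ℕ → ℕ, (∀ n, 1 ≤ d n) →
      Tendsto
        (fun n : ℕ => girgMeasure n β w₀ (d n)
          {ω | ((girgGraph lam ω).cliqueNum : ℝ) ≤ C * (n : ℝ) ^ ((3 - β) / 2)})
        atTop (𝓝 1) := by
  exact mainTheorem9_general β w₀ lam (by linarith) hβ₃ hw₀ hlam.le
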